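/- Let $\mathcal N^2$ be the collection of measure networks $N=(X,\mu,\omega)$, where $X$ is a Polish space, $\mu$ a Borel probability measure on $X$ and $\omega:X\times X\to[0,\infty)$ is in $L^2(\mu\otimes\mu)$. Let $\mathcal H^2$ be the collection of measure hypernetworks $H=(X,\mu,Y,\nu,\omega)$, where $(X,\mu)$, $(Y,\nu)$ are Polish spaces with Borel probability measures and $\omega:X\times Y\to[0,\infty)$ is in $L^2(\mu\otimes\nu)$. Let $\mathcal A^2$ be the collection of augmented measure networks $A=(X,\mu,Y,\nu,\omega_X,\omega_{XY})$, where $(X,\mu)$, $(Y,\nu)$ are as before and $\omega_X:X\times X\to[0,\infty)$, $\omega_{XY}:X\times Y\to[0,\infty)$ are in $L^2(\mu\otimes\mu)$ and $L^2(\mu\otimes\nu)$, respectively. Write $\Pi(\mu,\mu')$ for the set of couplings of $\mu$ and $\mu'$, and $(\tau-\tau')(a,a',b,b')=\tau(a,b)-\tau'(a',b')$ for kernels $\tau,\tau'$. The distances are $$d_{\mathcal N^2}(N,N')=\inf_{\pi\in\Pi(\mu,\mu')}\tfrac12\|\omega-\omega'\|_{L^2(\pi\otimes\pi)},\qquad d_{\mathcal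 H^2}(H,H')=\inf_{\pi\in\Pi(\mu,\mu'),\,\xi\in\Pi(\nu,\nu')}\tfrac12\|\omega-\omega'\|_{L^2(\pi\otimes\xi)},$$ $$d_{\mathcal A^2}(A,A')=\inf_{\pi\in\Pi(\mu,\mu'),\,\xi\in\Pi(\nu,\nu')}\tfrac12\left(\|\omega_X-\omega'_{X'}\|^2_{L^2(\pi\otimes\pi)}+\|\omega_{XY}-\omega'_{X'Y'}\|^2_{L^2(\pi\otimes\xi)}\right)^{1/2}.$$ For $k\ge 1$, a $k$-partitioned measure network $P=((X_i,\mu_i)_{i=1}^k,\omega)$ consists of pairwise disjoint Polish spaces $X_i$ with Borel probability measures $\mu_i$ and a kernel $\omega:(\sqcup_iX_i)\times(\sqcup_iX_i)\to[0,\infty)$ that is square integrable for $(\sum_i\mu_i)\otimes(\sum_i\mu_i)$. A weak isomorphism from $P$ to $P'$ is a tuple of Borel maps $\phi_i:X_i\to X_i'$ with $(\phi_i)_\#\mu_i=\mu_i'$ and $\omega(x,y)=\omega'(\phi_i(x),\phi_j(y))$ for $\mu_i\otimes\mu_j$-almost every $(x,y)\in X_i\times X_j$, for all $i,j$; $P$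 and $P'$ are weakly isomorphic if some $k$-partitioned measure network has weak isomorphisms to both. A measure network is a $1$-partitioned measure network; a measure hypernetwork or an augmented measure network is regarded as a $2$-partitioned measure network with $X_1=X$, $X_2=Y$, whose kernel is $\omega$ on $X\times Y$, respectively $\omega_X$ on $X\times X$ and $\omega_{XY}$ on $X\times Y$, and $0$ elsewhere. Two measure networks, hypernetworks or augmented networks are weakly isomorphic if the associated partitioned networks are; $[\mathcal N^2]$, $[\mathcal H^2]$, $[\mathcal A^2]$ are the sets of classes. A geodesic between points $x,y$ of a metric space $(E,d)$ is a path $\gamma:[0,1]\to E$ with $\gamma(0)=x$, $\gamma(1)=y$ and $d(\gamma(s),\gamma(t))=(t-s)d(x,y)$ for $0\le s\le t\le 1$. The space $(E,d)$ is an Alexandrov space of non-negative curvature if it is complete, any two of its points are joined by a geodesic, and $$d(\gamma(t),x)^2\ge(1-t)\,d(\gamma(0),x)^2+t\,d(\gamma(1),x)^2-t(1-t)\,d(\gamma(0),\gamma(1))^2$$ for every geodesic $\gamma$, every $x\in E$ and every $t\in[0,1]$. Then weak isomorphism is an equivalence relation on each of $\mathcal N^2$, $\mathcal H^2$, $\mathcal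 A^2$; the functions $d_{\mathcal N^2}$, $d_{\mathcal H^2}$, $d_{\mathcal A^2}$ induce well-defined metrics on $[\mathcal N^2]$, $[\mathcal H^2]$, $[\mathcal A^2]$; and each of the metric spaces $([\mathcal N^2],d_{\mathcal N^2})$, $([\mathcal H^2],d_{\mathcal H^2})$, $([\mathcal A^2],d_{\mathcal A^2})$ is an Alexandrov space of non-negative curvature. -/

import Mathlib

open MeasureTheory
open scoped ENNReal

universe u

namespace GeneralizedNetworks

/-! ## Generalized networks with square-integrable kernels -/

/-- A measure `2`-network `(X, μ, ω)`: a Polish space with a Borel probability measure and a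
nonnegative kernel `ω ∈ L²(μ ⊗ μ)`. -/
structure MeasureNetwork : Type (u + 1) where
  X : Type u
  [topX : TopologicalSpace X]
  [polishX : PolishSpace X]
  [measX : MeasurableSpace X]
  [borelX : BorelSpace X]
  μ : Measure X
  [probμ : IsProbabilityMeasure μ]
  ω : X × X → ℝ
  ω_nonneg : ∀ z, 0 ≤ ω z
  ω_memLp : MemLp ω 2 (μ.prod μ)

attribute [instance] MeasureNetwork.topX MeasureNetwork.polishX MeasureNetwork.measX
  MeasureNetwork.borelX MeasureNetwork.probμ

/-- A measure `2`-hypernetwork `(X, μ, Y, ν, ω)`: two Polish spaces with Borel probability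
measures and a nonnegative kernel `ω ∈ L²(μ ⊗ ν)`. -/
structure MeasureHypernetwork : Type (u + 1) where
  X : Type u
  [topX : TopologicalSpace X]
  [polishX : PolishSpace X]
  [measX : MeasurableSpace X]
  [borelX : BorelSpace X]
  μ : Measure X
  [probμ : IsProbabilityMeasure μ]
  Y : Type u
  [topY : TopologicalSpace Y]
  [polishY : PolishSpace Y]
  [measY : MeasurableSpace Y]
  [borelY : BorelSpace Y]
  ν : Measure Y
  [probν : IsProbabilityMeasure ν]
  ω : X × Y → ℝ
  ω_nonneg : ∀ z, 0 ≤ ω z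
  ω_memLp : MemLp ω 2 (μ.prod ν)

attribute [instance] MeasureHypernetwork.topX MeasureHypernetwork.polishX
  MeasureHypernetwork.measX MeasureHypernetwork.borelX MeasureHypernetwork.probμ
  MeasureHypernetwork.topY MeasureHypernetwork.polishY
  MeasureHypernetwork.measY MeasureHypernetwork.borelY MeasureHypernetwork.probν

/-- An augmented measure `2`-network `(X, μ, Y, ν, ω_X, ω_XY)`: two Polish spaces with Borel
probability measures and nonnegative kernels `ω_X ∈ L²(μ ⊗ μ)`, `ω_XY ∈ L²(μ ⊗ ν)`. -/
structure AugmentedMeasureNetwork : Type (u + 1) where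
  X : Type u
  [topX : TopologicalSpace X]
  [polishX : PolishSpace X]
  [measX : MeasurableSpace X]
  [borelX : BorelSpace X]
  μ : Measure X
  [probμ : IsProbabilityMeasure μ]
  Y : Type u
  [topY : TopologicalSpace Y]
  [polishY : PolishSpace Y]
  [measY : MeasurableSpace Y]
  [borelY : BorelSpace Y]
  ν : Measure Y
  [probν : IsProbabilityMeasure ν]
  ωX : X × X → ℝ
  ωX_nonneg : ∀ z, 0 ≤ ωX z
  ωX_memLp : MemLp ωX 2 (μ.prod μ)
  ωXY : X × Y → ℝ
  ωXY_nonneg : ∀ z, 0 ≤ ωXY z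
  ωXY_memLp : MemLp ωXY 2 (μ.prod ν)

attribute [instance] AugmentedMeasureNetwork.topX AugmentedMeasureNetwork.polishX
  AugmentedMeasureNetwork.measX AugmentedMeasureNetwork.borelX AugmentedMeasureNetwork.probμ
  AugmentedMeasureNetwork.topY AugmentedMeasureNetwork.polishY
  AugmentedMeasureNetwork.measY AugmentedMeasureNetwork.borelY AugmentedMeasureNetwork.probν

/-! ## Partitioned measure networks and weak isomorphism -/

/-- A `k`-partitioned measure `2`-network. The kernel on `(⊔ᵢ Xᵢ) × (⊔ᵢ Xᵢ)` is given by its blocks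
`ω i j : Xᵢ × Xⱼ → [0, ∞)`; it is in `L²(μ ⊗ μ)`, `μ = ∑ᵢ μᵢ`, exactly when every block is in
`L²(μᵢ ⊗ μⱼ)`. -/
structure PartitionedMeasureNetwork (k : ℕ) : Type (u + 1) where
  X : Fin k → Type u
  [topX : ∀ i, TopologicalSpace (X i)]
  [polishX : ∀ i, PolishSpace (X i)]
  [measX : ∀ i, MeasurableSpace (X i)]
  [borelX : ∀ i, BorelSpace (X i)]
  μ : ∀ i, Measure (X i)
  [probμ : ∀ i, IsProbabilityMeasure (μ i)]
  ω : ∀ i j, X i × X j → ℝ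
  ω_nonneg : ∀ i j z, 0 ≤ ω i j z
  ω_memLp : ∀ i j, MemLp (ω i j) 2 ((μ i).prod (μ j))

attribute [instance] PartitionedMeasureNetwork.topX PartitionedMeasureNetwork.polishX
  PartitionedMeasureNetwork.measX PartitionedMeasureNetwork.borelX PartitionedMeasureNetwork.probμ

namespace PartitionedMeasureNetwork

variable {k : ℕ}

/-- The tuple of (Borel measurable, not necessarily bijective) maps `φᵢ` is a weak isomorphism from
`P` to `P'`. -/
structure IsWeakIsomorphism (P P' : PartitionedMeasureNetwork.{u} k)
    (φ : ∀ i, P.X i → P'.X i) : Prop where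
  measurePreserving : ∀ i, MeasurePreserving (φ i) (P.μ i) (P'.μ i)
  kernel_eq : ∀ i j, ∀ᵐ z ∂((P.μ i).prod (P.μ j)), P.ω i j z = P'.ω i j (φ i z.1, φ j z.2)

/-- `P` and `P'` are weakly isomorphic: a third network has weak isomorphisms to both. -/
def WeaklyIsomorphic (P P' : PartitionedMeasureNetwork.{u} k) : Prop :=
  ∃ (Q : PartitionedMeasureNetwork.{u} k) (φ : ∀ i, Q.X i → P.X i) (φ' : ∀ i, Q.X i → P'.X i),
    IsWeakIsomorphism Q P φ ∧ IsWeakIsomorphism Q P' φ'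

end PartitionedMeasureNetwork

/-! ## Generalized networks as partitioned networks -/

/-- The family of two spaces `X₁ = A`, `X₂ = B`. -/
def Pair (A B : Type u) : Fin 2 → Type u
  | 0 => A
  | 1 => B

instance {A B : Type u} [hA : TopologicalSpace A] [hB : TopologicalSpace B] :
    ∀ i, TopologicalSpace (Pair A B i)
  | 0 => hA
  | 1 => hB

instance {A B : Type u} [TopologicalSpace A] [TopologicalSpace B]
    [hA : PolishSpace A] [hB : PolishSpace B] : ∀ i, PolishSpace (Pair A B i)
  | 0 => hA
  | 1 => hB

instance {A B : Type u} [hA : MeasurableSpace A] [hB : MeasurableSpace B] :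
    ∀ i, MeasurableSpace (Pair A B i)
  | 0 => hA
  | 1 => hB

instance {A B : Type u} [TopologicalSpace A] [TopologicalSpace B] [MeasurableSpace A]
    [MeasurableSpace B] [hA : BorelSpace A] [hB : BorelSpace B] : ∀ i, BorelSpace (Pair A B i)
  | 0 => hA
  | 1 => hB

/-- The pair of measures `μ₁ = μ`, `μ₂ = ν`. -/
def pairMeasure {A B : Type u} [MeasurableSpace A] [MeasurableSpace B]
    (μ : Measure A) (ν : Measure B) : ∀ i, Measure (Pair A B i)
  | 0 => μ
  | 1 => ν

instance {A B : Type u} [MeasurableSpace A] [MeasurableSpace B]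
    (μ : Measure A) (ν : Measure B) [hμ : IsProbabilityMeasure μ] [hν : IsProbabilityMeasure ν] :
    ∀ i, IsProbabilityMeasure (pairMeasure μ ν i)
  | 0 => hμ
  | 1 => hν

/-- A measure network is the same thing as a `1`-partitioned measure network. -/
def MeasureNetwork.toPartitioned (N : MeasureNetwork.{u}) : PartitionedMeasureNetwork.{u} 1 where
  X := fun _ => N.X
  μ := fun _ => N.μ
  ω := fun _ _ => N.ω
  ω_nonneg := fun _ _ => N.ω_nonneg
  ω_memLp := fun _ _ => N.ω_memLp

/-- The kernel of the `2`-partitioned network of a hypernetwork: `ω` on `X × Y`, and `0` on the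
three other blocks. -/
def hypernetworkKernel {A B : Type u} (ω : A × B → ℝ) :
    ∀ i j, Pair A B i × Pair A B j → ℝ
  | 0, 0 => fun _ => 0
  | 0, 1 => ω
  | 1, 0 => fun _ => 0
  | 1, 1 => fun _ => 0

/-- The embedding of hypernetworks into `2`-partitioned networks. -/
def MeasureHypernetwork.toPartitioned (H : MeasureHypernetwork.{u}) :
    PartitionedMeasureNetwork.{u} 2 where
  X := Pair H.X H.Y
  μ := pairMeasure H.μ H.ν
  ω := hypernetworkKernel H.ω
  ω_nonneg
    | 0, 0 => fun _ => le_rfl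
    | 0, 1 => H.ω_nonneg
    | 1, 0 => fun _ => le_rfl
    | 1, 1 => fun _ => le_rfl
  ω_memLp
    | 0, 0 => MemLp.zero'
    | 0, 1 => H.ω_memLp
    | 1, 0 => MemLp.zero'
    | 1, 1 => MemLp.zero'

/-- The kernel of the `2`-partitioned network of an augmented network: `ω_X` on `X × X`, `ω_XY` on
`X × Y`, and `0` on the two other blocks. -/
def augmentedKernel {A B : Type u} (ωX : A × A → ℝ) (ωXY : A × B → ℝ) :
    ∀ i j, Pair A B i × Pair A B j → ℝ
  | 0, 0 => ωX
  | 0, 1 => ωXY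
  | 1, 0 => fun _ => 0
  | 1, 1 => fun _ => 0

/-- The embedding of augmented measure networks into `2`-partitioned networks. -/
def AugmentedMeasureNetwork.toPartitioned (A : AugmentedMeasureNetwork.{u}) :
    PartitionedMeasureNetwork.{u} 2 where
  X := Pair A.X A.Y
  μ := pairMeasure A.μ A.ν
  ω := augmentedKernel A.ωX A.ωXY
  ω_nonneg
    | 0, 0 => A.ωX_nonneg
    | 0, 1 => A.ωXY_nonneg
    | 1, 0 => fun _ => le_rfl
    | 1, 1 => fun _ => le_rfl
  ω_memLp
    | 0, 0 => A.ωX_memLp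
    | 0, 1 => A.ωXY_memLp
    | 1, 0 => MemLp.zero'
    | 1, 1 => MemLp.zero'

/-- Weak isomorphism of measure networks. -/
def MeasureNetwork.WeaklyIsomorphic (N N' : MeasureNetwork.{u}) : Prop :=
  N.toPartitioned.WeaklyIsomorphic N'.toPartitioned

/-- Weak isomorphism of measure hypernetworks, induced by the embedding. -/
def MeasureHypernetwork.WeaklyIsomorphic (H H' : MeasureHypernetwork.{u}) : Prop :=
  H.toPartitioned.WeaklyIsomorphic H'.toPartitioned

/-- Weak isomorphism of augmented measure networks, induced by the embedding. -/
def AugmentedMeasureNetwork.WeaklyIsomorphic (A A' : AugmentedMeasureNetwork.{u}) : Prop :=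
  A.toPartitioned.WeaklyIsomorphic A'.toPartitioned

/-! ## The distances for `p = 2` -/

/-- The set `Π(μ, μ')` of couplings of `μ` and `μ'`. -/
def couplings {A A' : Type*} [MeasurableSpace A] [MeasurableSpace A']
    (μ : Measure A) (μ' : Measure A') : Set (Measure (A × A')) :=
  {π | π.map Prod.fst = μ ∧ π.map Prod.snd = μ'}

/-- The function `τ - τ' : ((a, a'), (b, b')) ↦ τ (a, b) - τ' (a', b')`. -/
def kernelDiff {A A' B B' : Type*} (τ : A × B → ℝ) (τ' : A' × B' → ℝ) :
    (A × A') × (B × B') → ℝ :=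
  fun z => τ (z.1.1, z.2.1) - τ' (z.1.2, z.2.2)

/-- The network (Gromov-Wasserstein) `2`-distance. -/
noncomputable def MeasureNetwork.d (N N' : MeasureNetwork.{u}) : ℝ≥0∞ :=
  ⨅ π ∈ couplings N.μ N'.μ, 2⁻¹ * eLpNorm (kernelDiff N.ω N'.ω) 2 (π.prod π)

/-- The hypernetwork `2`-distance. -/
noncomputable def MeasureHypernetwork.d (H H' : MeasureHypernetwork.{u}) : ℝ≥0∞ :=
  ⨅ π ∈ couplings H.μ H'.μ, ⨅ ξ ∈ couplings H.ν H'.ν,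
    2⁻¹ * eLpNorm (kernelDiff H.ω H'.ω) 2 (π.prod ξ)

/-- The augmented network `2`-distance. -/
noncomputable def AugmentedMeasureNetwork.d (A A' : AugmentedMeasureNetwork.{u}) : ℝ≥0∞ :=
  ⨅ π ∈ couplings A.μ A'.μ, ⨅ ξ ∈ couplings A.ν A'.ν,
    2⁻¹ * (eLpNorm (kernelDiff A.ωX A'.ωX) 2 (π.prod π) ^ 2 +
      eLpNorm (kernelDiff A.ωXY A'.ωXY) 2 (π.prod ξ) ^ 2) ^ (1 / 2 : ℝ)

/-! ## Alexandrov spaces of non-negative curvature -/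

/-- `γ : [0, 1] → E` is a geodesic between `x` and `y`. -/
structure IsGeodesic {E : Type*} [MetricSpace E] (γ : unitInterval → E) (x y : E) : Prop where
  source : γ 0 = x
  target : γ 1 = y
  dist_eq : ∀ s t : unitInterval, s ≤ t → dist (γ s) (γ t) = ((t : ℝ) - (s : ℝ)) * dist x y

/-- A complete geodesic space with curvature bounded below by zero. -/
structure IsAlexandrovNonneg (E : Type*) [MetricSpace E] : Prop where
  complete : CompleteSpace E
  geodesic : ∀ x y : E, ∃ γ : unitInterval → E, IsGeodesic γ x y
  curvature : ∀ γ : unitInterval → E, IsGeodesic γ (γ 0) (γ 1) → ∀ (x : E) (t : unitInterval),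
    (1 - (t : ℝ)) * dist (γ 0) x ^ 2 + (t : ℝ) * dist (γ 1) x ^ 2
      - (t : ℝ) * (1 - (t : ℝ)) * dist (γ 0) (γ 1) ^ 2 ≤ dist (γ t) x ^ 2

/-- `r` is an equivalence relation, `d` descends to a well-defined (finite) metric on the set of
`r`-classes, and the resulting metric space is an Alexandrov space of non-negative curvature. -/
def IsAlexandrovNonnegModulo {α : Type*} (r : α → α → Prop) (d : α → α → ℝ≥0∞) : Prop :=
  Equivalence r ∧ ∃ _ : MetricSpace (Quot r),
    (∀ x y : α, edist (Quot.mk r x) (Quot.mk r y) = d x y) ∧ IsAlexandrovNonneg (Quot r)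

end GeneralizedNetworks

namespace GeneralizedNetworks

open ProbabilityTheory unitInterval

/-! ## Realizing couplings on a common probability space -/

/-! Networks of all three kinds are `k`-partitioned networks whose kernel vanishes almost everywhere
outside a fixed set `S` of blocks, and the three distances are restrictions of the partitioned
distance `d`. It therefore suffices to treat partitioned networks supported on `S`, up to weak
isomorphism.

Couplings with fixed marginals form a weakly compact set on which the distortion is continuous, so
optimal couplings exist (`exists_cost_eq_d`). A coupling is the joint law of a variable and of a
function of that variable and independent uniform noise. Hence countably many optimal couplings,
arranged in a star or in a chain, can be realized at once on one probability space of uniform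
sequences (`exists_star_lift`, `exists_chain_lift`). Pulling kernels back to this space turns
networks into points of the Hilbert space `KernelSpace`. Twice the network distance is always at
most the Hilbert distance, with equality along the edges of the star or chain. Conversely, every
nonnegative point of this space is the kernel of a network on the noise (`ofKernel`).

Nonnegativity and support in `S` survive limits and convex combinations, so the geometry can be read
off in the Hilbert space. A rapidly Cauchy sequence, realized as a chain, converges there. The
segment between two optimally coupled points projects to a geodesic. For curvature, take a star
centred at the intermediate point `γ t`: its distances to the two endpoints and to the test point
are exact, while all other distances can only have grown. The centre then lies on the segment
between the endpoints, and the Hilbert space identity becomes the required inequality. The metric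
axioms come from the same realizations, and distance zero means that an optimal coupling carries a
common network above both. -/

/-- A coupling with first marginal `μ` is realized by a measurable function of a `μ`-distributed
variable and an independent uniform variable. -/
theorem exists_measurable_map_prod_volume_eq {A B : Type*} [MeasurableSpace A]
    [MeasurableSpace B] [StandardBorelSpace B] [Nonempty B] (μ : Measure A)
    [IsProbabilityMeasure μ] (π : Measure (A × B)) (hπ : π.map Prod.fst = μ) :
    ∃ f : A × I → B, Measurable f ∧
      (μ.prod (volume : Measure I)).map (fun z => (z.1, f z)) = π := by
  have : IsProbabilityMeasure π := by
    have : IsProbabilityMeasure (π.map Prod.fst) := by rw [hπ]; infer_instance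
    exact Measure.isProbabilityMeasure_of_map Prod.fst
  -- Each conditional law of the second variable given the first is the law of a function of a
  -- uniform variable, measurably in the condition.
  obtain ⟨f, hf, hfm⟩ := Kernel.exists_measurable_map_eq_unitInterval π.condKernel
  refine ⟨fun z => f z.1 z.2, hf, ?_⟩
  have hm : Measurable fun z : A × I => (z.1, f z.1 z.2) := measurable_fst.prodMk hf
  conv_rhs => rw [← π.disintegrate π.condKernel]
  ext s hs
  rw [Measure.map_apply hm hs, Measure.prod_apply (hm hs), Measure.compProd_apply hs,
    Measure.fst, hπ]
  refine lintegral_congr fun a => ?_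
  rw [← hfm a, Measure.map_apply hf.of_uncurry_left (measurable_prodMk_left hs)]
  rfl

/-- The sample space: sequences of points of the unit interval. -/
abbrev Noise : Type u := ULift.{u} (ℕ → I)

instance : PolishSpace Noise.{u} :=
  (Homeomorph.ulift (X := ℕ → I)).isClosedEmbedding.polishSpace

/-- The law of a sequence of independent uniform variables. -/
noncomputable def noise : Measure Noise.{u} :=
  (Measure.infinitePi fun _ : ℕ => (volume : Measure I)).map ULift.up

theorem measurePreserving_down :
    MeasurePreserving ULift.down noise.{u}
      (Measure.infinitePi fun _ : ℕ => (volume : Measure I)) :=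
  ⟨measurable_down, by
    rw [noise, Measure.map_map measurable_down measurable_up]
    exact Measure.map_id⟩

instance : IsProbabilityMeasure noise.{u} :=
  Measure.isProbabilityMeasure_map measurable_up.aemeasurable

theorem map_noise_eval (n : ℕ) : noise.{u}.map (fun w => w.down n) = volume :=
  ((measurePreserving_eval_infinitePi (fun _ : ℕ => (volume : Measure I)) n).comp
        measurePreserving_down).map_eq

/-- A function of the coordinates in `s` is independent of every coordinate outside of `s`. -/
theorem map_restrict_prodMk_noise {A : Type*} [MeasurableSpace A] (s : Finset ℕ) {n : ℕ}
    (hn : n ∉ s) {g : (s → I) → A} (hg : Measurable g) :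
    noise.{u}.map (fun w => (g (s.restrict w.down), w.down n)) =
      (noise.{u}.map fun w => g (s.restrict w.down)).prod volume := by
  have hind : iIndepFun (fun (i : ℕ) (w : Noise.{u}) => w.down i) noise.{u} := by
    rw [iIndepFun_iff_map_fun_eq_infinitePi_map (fun i => by fun_prop)]
    simp_rw [map_noise_eval]
    exact measurePreserving_down.map_eq
  have h2 := hind.indepFun_finset s {n} (by simpa using hn) (fun i => by fun_prop)
  have hv : Measurable fun v : (({n} : Finset ℕ) → I) => v ⟨n, Finset.mem_singleton_self n⟩ :=
    measurable_pi_apply _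
  have h3 := h2.comp hg hv
  have h4 := (indepFun_iff_map_prod_eq_prod_map_map
    (by fun_prop) (by fun_prop)).1 h3
  refine h4.trans ?_
  congr 1
  exact map_noise_eval n

/-- One step of the realization: a coupling of the law of a function of the coordinates in `s`. -/
theorem map_prodMk_noise_eq_of_coupling {A B : Type*} [MeasurableSpace A] [MeasurableSpace B]
    {μ : Measure A} {π : Measure (A × B)} {f : A × I → B} (hf : Measurable f)
    (hfπ : (μ.prod (volume : Measure I)).map (fun z => (z.1, f z)) = π)
    (s : Finset ℕ) {n : ℕ} (hn : n ∉ s) {g : (s → I) → A} (hg : Measurable g)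
    (hgμ : noise.{u}.map (fun w => g (s.restrict w.down)) = μ) :
    noise.{u}.map (fun w => (g (s.restrict w.down), f (g (s.restrict w.down), w.down n))) = π := by
  rw [← hfπ, ← hgμ, ← map_restrict_prodMk_noise s hn hg, Measure.map_map]
  · rfl
  · fun_prop
  · fun_prop

/-- Couplings of a measure with a sequence of measures are realized simultaneously. -/
theorem exists_star_realization {A : Type*} [MeasurableSpace A] [StandardBorelSpace A]
    (μ : Measure A) [IsProbabilityMeasure μ] {B : ℕ → Type*} [∀ n, MeasurableSpace (B n)]
    [∀ n, StandardBorelSpace (B n)] [∀ n, Nonempty (B n)] (π : ∀ n, Measure (A × B n))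
    (hπ : ∀ n, (π n).map Prod.fst = μ) :
    ∃ (φ : Noise.{u} → A) (ψ : ∀ n, Noise.{u} → B n), Measurable φ ∧ (∀ n, Measurable (ψ n)) ∧
      noise.map φ = μ ∧ ∀ n, noise.map (fun w => (φ w, ψ n w)) = π n := by
  have : Nonempty A := μ.nonempty_of_neZero
  obtain ⟨g, hg, hgμ⟩ := μ.exists_measurable_map_eq
  choose f hf hfπ using fun n => exists_measurable_map_prod_volume_eq μ (π n) (hπ n)
  have hφ : noise.{u}.map (fun w => g (w.down 0)) = μ := by
    rw [← hgμ, ← map_noise_eval.{u} 0, Measure.map_map hg (by fun_prop)]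
    rfl
  -- Coordinate 0 generates the centre of the star and coordinate `n + 1` drives its `n`-th leg, so
  -- each leg uses noise independent of the centre.
  refine ⟨fun w => g (w.down 0), fun n w => f n (g (w.down 0), w.down (n + 1)),
    by fun_prop, fun n => by fun_prop, hφ, fun n => ?_⟩
  exact map_prodMk_noise_eq_of_coupling (hf n) (hfπ n) {0} (by simp)
    (g := fun v => g (v ⟨0, by simp⟩)) (by fun_prop) hφ

/-- Couplings of the consecutive terms of a sequence of measures are realized simultaneously. -/
theorem exists_chain_realization {B : ℕ → Type*} [∀ n, MeasurableSpace (B n)]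
    [∀ n, StandardBorelSpace (B n)] (μ : ∀ n, Measure (B n)) [∀ n, IsProbabilityMeasure (μ n)]
    (π : ∀ n, Measure (B n × B (n + 1))) (hπ : ∀ n, (π n).map Prod.fst = μ n)
    (hπ' : ∀ n, (π n).map Prod.snd = μ (n + 1)) :
    ∃ φ : ∀ n, Noise.{u} → B n, (∀ n, Measurable (φ n)) ∧ (∀ n, noise.map (φ n) = μ n) ∧
      ∀ n, noise.map (fun w => (φ n w, φ (n + 1) w)) = π n := by
  have : ∀ n, Nonempty (B n) := fun n => (μ n).nonempty_of_neZero
  obtain ⟨g, hg, hgμ⟩ := (μ 0).exists_measurable_map_eq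
  choose f hf hfπ using fun n => exists_measurable_map_prod_volume_eq (μ n) (π n) (hπ n)
  let φ : ∀ n, Noise.{u} → B n := fun n =>
    Nat.rec (motive := fun n => Noise.{u} → B n) (fun w => g (w.down 0))
      (fun n h w => f n (h w, w.down (n + 1))) n
  -- The invariant says that `φ n` reads only coordinates `0, …, n`. This makes coordinate `n + 1`
  -- fresh noise for the next link.
  have key : ∀ n, (∃ h : (Finset.range (n + 1) → I) → B n, Measurable h ∧
      φ n = fun w => h ((Finset.range (n + 1)).restrict w.down)) ∧ noise.map (φ n) = μ n := by
    intro n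
    induction n with
    | zero =>
      refine ⟨⟨fun v => g (v ⟨0, by simp⟩), by fun_prop, rfl⟩, ?_⟩
      rw [← hgμ, ← map_noise_eval.{u} 0, Measure.map_map hg (by fun_prop)]
      rfl
    | succ n ih =>
      obtain ⟨⟨h, hh, hφ⟩, hμ⟩ := ih
      -- The default value `0` is never read: `h` uses only indices below `n + 1`, all of which lie
      -- in `range (n + 2)`.
      refine ⟨⟨fun v => f n (h ((Finset.range (n + 1)).restrict fun i =>
        if hi : i ∈ Finset.range (n + 2) then v ⟨i, hi⟩ else 0), v ⟨n + 1, by simp⟩), ?_, ?_⟩, ?_⟩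
      · refine (hf n).comp ((hh.comp ?_).prodMk (measurable_pi_apply _))
        refine measurable_pi_lambda _ fun i => ?_
        have hi : (i : ℕ) ∈ Finset.range (n + 2) := by
          have := i.2
          simp only [Finset.mem_range] at this ⊢
          omega
        simp only [Finset.restrict, hi, dif_pos]
        fun_prop
      · funext w
        change f n (φ n w, w.down (n + 1)) = _
        rw [hφ]
        refine congrArg (fun y => f n (h y, w.down (n + 1))) (funext fun i => ?_)
        have hi : (i : ℕ) ∈ Finset.range (n + 2) := by
          have := i.2
          simp only [Finset.mem_range] at this ⊢
          omega
        simp [Finset.restrict, hi]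
      · have := map_prodMk_noise_eq_of_coupling (hf n) (hfπ n) (Finset.range (n + 1))
          (n := n + 1) (by simp) hh (by rw [← hφ, hμ])
        rw [← hπ' n, ← this, Measure.map_map measurable_snd (by fun_prop)]
        congr 1
        funext w
        change f n (φ n w, w.down (n + 1)) = _
        rw [hφ]
        rfl
  have hφm : ∀ n, Measurable (φ n) := fun n => by
    obtain ⟨⟨h, hh, hφ⟩, -⟩ := key n
    rw [hφ]
    fun_prop
  refine ⟨φ, hφm, fun n => (key n).2, fun n => ?_⟩
  obtain ⟨⟨h, hh, hφ⟩, hμ⟩ := key n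
  have := map_prodMk_noise_eq_of_coupling (hf n) (hfπ n) (Finset.range (n + 1))
    (n := n + 1) (by simp) hh (by rw [← hφ, hμ])
  rw [← this]
  congr 1
  funext w
  change (φ n w, f n (φ n w, w.down (n + 1))) = _
  rw [hφ]

end GeneralizedNetworks

namespace GeneralizedNetworks

open Filter Topology BoundedContinuousFunction

/-! ## Compactness of the set of couplings and continuity of the distortion -/

section Couplings

variable {A A' : Type*} [MeasurableSpace A] [MeasurableSpace A']

theorem isProbabilityMeasure_of_mem_couplings {μ : Measure A} [IsProbabilityMeasure μ]
    {μ' : Measure A'} {π : Measure (A × A')} (h : π ∈ couplings μ μ') :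
    IsProbabilityMeasure π := by
  have : IsProbabilityMeasure (π.map Prod.fst) := by rw [h.1]; infer_instance
  exact Measure.isProbabilityMeasure_of_map Prod.fst

theorem prod_mem_couplings (μ : Measure A) [IsProbabilityMeasure μ]
    (μ' : Measure A') [IsProbabilityMeasure μ'] : μ.prod μ' ∈ couplings μ μ' :=
  ⟨measurePreserving_fst.map_eq, measurePreserving_snd.map_eq⟩

theorem measurePreserving_fst_of_mem_couplings {μ : Measure A} {μ' : Measure A'}
    {π : Measure (A × A')} (h : π ∈ couplings μ μ') : MeasurePreserving Prod.fst π μ :=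
  ⟨measurable_fst, h.1⟩

theorem measurePreserving_snd_of_mem_couplings {μ : Measure A} {μ' : Measure A'}
    {π : Measure (A × A')} (h : π ∈ couplings μ μ') : MeasurePreserving Prod.snd π μ' :=
  ⟨measurable_snd, h.2⟩

theorem map_prodMk_mem_couplings {Ω : Type*} [MeasurableSpace Ω] {ℙ : Measure Ω}
    {μ : Measure A} {μ' : Measure A'} {φ : Ω → A} {φ' : Ω → A'}
    (hφ : MeasurePreserving φ ℙ μ) (hφ' : MeasurePreserving φ' ℙ μ') :
    ℙ.map (fun w => (φ w, φ' w)) ∈ couplings μ μ' := by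
  have hm : Measurable fun w => (φ w, φ' w) := hφ.measurable.prodMk hφ'.measurable
  constructor
  · rw [Measure.map_map measurable_fst hm]; exact hφ.map_eq
  · rw [Measure.map_map measurable_snd hm]; exact hφ'.map_eq

variable [TopologicalSpace A] [PolishSpace A] [BorelSpace A] [TopologicalSpace A']
  [PolishSpace A'] [BorelSpace A']

/-- The set of couplings of two Borel probability measures on Polish spaces is compact. -/
theorem isCompact_couplings (μ : Measure A) [IsProbabilityMeasure μ] (μ' : Measure A')
    [IsProbabilityMeasure μ'] :
    IsCompact {π : ProbabilityMeasure (A × A') | (π : Measure (A × A')) ∈ couplings μ μ'} := by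
  set S := {π : ProbabilityMeasure (A × A') | (π : Measure (A × A')) ∈ couplings μ μ'}
  have hclosed : IsClosed S := by
    have h : S = (fun π : ProbabilityMeasure (A × A') =>
          (π.map (f := Prod.fst) measurable_fst.aemeasurable,
            π.map (f := Prod.snd) measurable_snd.aemeasurable)) ⁻¹'
        {((⟨μ, inferInstance⟩, ⟨μ', inferInstance⟩) :
          ProbabilityMeasure A × ProbabilityMeasure A')} := by
      ext π
      exact ⟨fun h => Prod.ext (Subtype.ext h.1) (Subtype.ext h.2), fun h =>
        ⟨congrArg Subtype.val (congrArg Prod.fst h), congrArg Subtype.val (congrArg Prod.snd h)⟩⟩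
    rw [h]
    exact isClosed_singleton.preimage
      ((ProbabilityMeasure.continuous_map continuous_fst).prodMk
        (ProbabilityMeasure.continuous_map continuous_snd))
  have htight : IsTightMeasureSet {((π : ProbabilityMeasure (A × A')) : Measure (A × A')) |
      π ∈ S} := by
    -- Tightness on a product follows from tightness of the marginals, and here each marginal is a
    -- single fixed measure.
    refine IsTightMeasureSet.prodMk ?_ ?_
    · refine (isTightMeasureSet_singleton (μ := μ)).subset ?_
      rintro _ ⟨_, ⟨π, hπ, rfl⟩, rfl⟩
      exact hπ.1
    · refine (isTightMeasureSet_singleton (μ := μ')).subset ?_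
      rintro _ ⟨_, ⟨π, hπ, rfl⟩, rfl⟩
      exact hπ.2
  have := isCompact_closure_of_isTightMeasureSet htight
  rwa [hclosed.closure_eq] at this

end Couplings

section Distortion

variable {A A' B B' : Type*} [MeasurableSpace A] [MeasurableSpace A'] [MeasurableSpace B]
  [MeasurableSpace B']

theorem measurePreserving_prodMap_fst {μ : Measure A} {μ' : Measure A'} {ν : Measure B}
    {ν' : Measure B'} [IsProbabilityMeasure μ] [IsProbabilityMeasure ν]
    {π : Measure (A × A')} {ξ : Measure (B × B')} (hπ : π ∈ couplings μ μ')
    (hξ : ξ ∈ couplings ν ν') :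
    MeasurePreserving (fun z : (A × A') × (B × B') => (z.1.1, z.2.1)) (π.prod ξ) (μ.prod ν) := by
  have := isProbabilityMeasure_of_mem_couplings hπ
  have := isProbabilityMeasure_of_mem_couplings hξ
  exact (measurePreserving_fst_of_mem_couplings hπ).prod
    (measurePreserving_fst_of_mem_couplings hξ)

theorem measurePreserving_prodMap_snd {μ : Measure A} {μ' : Measure A'} {ν : Measure B}
    {ν' : Measure B'} [IsProbabilityMeasure μ] [IsProbabilityMeasure ν]
    [IsProbabilityMeasure μ'] [IsProbabilityMeasure ν']
    {π : Measure (A × A')} {ξ : Measure (B × B')} (hπ : π ∈ couplings μ μ')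
    (hξ : ξ ∈ couplings ν ν') :
    MeasurePreserving (fun z : (A × A') × (B × B') => (z.1.2, z.2.2))
      (π.prod ξ) (μ'.prod ν') := by
  have := isProbabilityMeasure_of_mem_couplings hπ
  have := isProbabilityMeasure_of_mem_couplings hξ
  exact (measurePreserving_snd_of_mem_couplings hπ).prod
    (measurePreserving_snd_of_mem_couplings hξ)

theorem memLp_kernelDiff {μ : Measure A} {μ' : Measure A'} {ν : Measure B}
    {ν' : Measure B'} [IsProbabilityMeasure μ] [IsProbabilityMeasure ν]
    [IsProbabilityMeasure μ'] [IsProbabilityMeasure ν'] {τ : A × B → ℝ} {τ' : A' × B' → ℝ}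
    (hτ : MemLp τ 2 (μ.prod ν)) (hτ' : MemLp τ' 2 (μ'.prod ν'))
    {π : Measure (A × A')} {ξ : Measure (B × B')} (hπ : π ∈ couplings μ μ')
    (hξ : ξ ∈ couplings ν ν') :
    MemLp (kernelDiff τ τ') 2 (π.prod ξ) :=
  (hτ.comp_measurePreserving (measurePreserving_prodMap_fst hπ hξ)).sub
    (hτ'.comp_measurePreserving (measurePreserving_prodMap_snd hπ hξ))

variable [TopologicalSpace A] [PolishSpace A] [BorelSpace A] [TopologicalSpace A']
  [PolishSpace A'] [BorelSpace A'] [TopologicalSpace B] [PolishSpace B] [BorelSpace B]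
  [TopologicalSpace B'] [PolishSpace B'] [BorelSpace B']

/-- For bounded continuous kernels the squared norm is the integral of a bounded continuous function
against the product coupling, and forming that product is weakly continuous. -/
theorem continuous_eLpNorm_kernelDiff (g : (A × B) →ᵇ ℝ) (g' : (A' × B') →ᵇ ℝ) :
    Continuous fun p : ProbabilityMeasure (A × A') × ProbabilityMeasure (B × B') =>
      (eLpNorm (kernelDiff g g') 2 ((p.1 : Measure (A × A')).prod
        (p.2 : Measure (B × B')))).toReal := by
  let h₁ : ((A × A') × (B × B')) →ᵇ ℝ :=
    g.compContinuous ⟨fun z => (z.1.1, z.2.1), by fun_prop⟩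
  let h₂ : ((A × A') × (B × B')) →ᵇ ℝ :=
    g'.compContinuous ⟨fun z => (z.1.2, z.2.2), by fun_prop⟩
  let h : ((A × A') × (B × B')) →ᵇ ℝ := h₁ - h₂
  have key : ∀ p : ProbabilityMeasure (A × A') × ProbabilityMeasure (B × B'),
      (eLpNorm (kernelDiff g g') 2 ((p.1 : Measure (A × A')).prod
        (p.2 : Measure (B × B')))).toReal =
      Real.sqrt (∫ z, (h * h) z ∂((p.1.prod p.2 : ProbabilityMeasure _) :
        Measure ((A × A') × (B × B')))) := by
    intro p
    have hmem : MemLp h 2 ((p.1 : Measure (A × A')).prod (p.2 : Measure (B × B'))) :=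
      MemLp.of_bound h.continuous.aestronglyMeasurable ‖h‖
        (Eventually.of_forall fun z => h.norm_coe_le_norm z)
    change (eLpNorm h 2 _).toReal = _
    rw [hmem.eLpNorm_eq_integral_rpow_norm (by norm_num) (by norm_num),
      ENNReal.toReal_ofReal (by positivity), Real.sqrt_eq_rpow]
    simp only [ENNReal.toReal_ofNat, Real.rpow_two, Real.norm_eq_abs, sq_abs, one_div,
      ← sq]
    rfl
  simp_rw [key]
  refine Real.continuous_sqrt.comp ?_
  exact (ProbabilityMeasure.continuous_integral_boundedContinuousFunction (h * h)).comp
    ProbabilityMeasure.continuous_prod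

/-- The `L²`-norm of the difference of two kernels depends continuously on the couplings. -/
theorem continuousOn_eLpNorm_kernelDiff {μ : Measure A} {μ' : Measure A'} {ν : Measure B}
    {ν' : Measure B'} [IsProbabilityMeasure μ] [IsProbabilityMeasure ν]
    [IsProbabilityMeasure μ'] [IsProbabilityMeasure ν'] {τ : A × B → ℝ} {τ' : A' × B' → ℝ}
    (hτ : MemLp τ 2 (μ.prod ν)) (hτ' : MemLp τ' 2 (μ'.prod ν')) :
    ContinuousOn (fun p : ProbabilityMeasure (A × A') × ProbabilityMeasure (B × B') =>
      (eLpNorm (kernelDiff τ τ') 2 ((p.1 : Measure (A × A')).prod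
        (p.2 : Measure (B × B')))).toReal)
      {p | (p.1 : Measure (A × A')) ∈ couplings μ μ' ∧
        (p.2 : Measure (B × B')) ∈ couplings ν ν'} := by
  -- Bounded continuous kernels approximate `τ` and `τ'` in `L²`. The resulting error does not
  -- depend on the couplings, because their marginals are fixed; the two errors of `ε / 3` add up to
  -- less than `ε`.
  refine continuousOn_of_uniform_approx_of_continuousOn fun u hu => ?_
  obtain ⟨ε, hε, hu⟩ := Metric.mem_uniformity_dist.1 hu
  have hε3 : ENNReal.ofReal (ε / 3) ≠ 0 := by
    simpa using hε
  obtain ⟨g, hg, hgm⟩ := hτ.exists_boundedContinuous_eLpNorm_sub_le (by norm_num) hε3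
  obtain ⟨g', hg', hgm'⟩ := hτ'.exists_boundedContinuous_eLpNorm_sub_le (by norm_num) hε3
  refine ⟨_, (continuous_eLpNorm_kernelDiff g g').continuousOn, fun p hp => hu ?_⟩
  obtain ⟨hπ, hξ⟩ := hp
  have m1 := memLp_kernelDiff hτ hτ' hπ hξ
  have m2 := memLp_kernelDiff hgm hgm' hπ hξ
  have e1 : eLpNorm (fun z : (A × A') × (B × B') => (τ - ⇑g) (z.1.1, z.2.1)) 2
      ((p.1 : Measure (A × A')).prod (p.2 : Measure (B × B'))) ≤ ENNReal.ofReal (ε / 3) := by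
    rw [← Function.comp_def (τ - ⇑g), eLpNorm_comp_measurePreserving (hτ.sub hgm).1
      (measurePreserving_prodMap_fst hπ hξ)]
    exact hg
  have e2 : eLpNorm (fun z : (A × A') × (B × B') => (τ' - ⇑g') (z.1.2, z.2.2)) 2
      ((p.1 : Measure (A × A')).prod (p.2 : Measure (B × B'))) ≤ ENNReal.ofReal (ε / 3) := by
    rw [← Function.comp_def (τ' - ⇑g'), eLpNorm_comp_measurePreserving (hτ'.sub hgm').1
      (measurePreserving_prodMap_snd hπ hξ)]
    exact hg'
  have a1 := ((hτ.sub hgm).comp_measurePreserving (measurePreserving_prodMap_fst hπ hξ)).1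
  have a2 := ((hτ'.sub hgm').comp_measurePreserving (measurePreserving_prodMap_snd hπ hξ)).1
  have e3 : eLpNorm (kernelDiff τ τ' - kernelDiff g g') 2
      ((p.1 : Measure (A × A')).prod (p.2 : Measure (B × B'))) ≤
      ENNReal.ofReal (2 * (ε / 3)) := by
    have : kernelDiff τ τ' - kernelDiff g g' =
        (fun z : (A × A') × (B × B') => (τ - ⇑g) (z.1.1, z.2.1)) -
        (fun z : (A × A') × (B × B') => (τ' - ⇑g') (z.1.2, z.2.2)) := by
      funext z
      simp only [kernelDiff, Pi.sub_apply]
      ring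
    rw [this, two_mul, ENNReal.ofReal_add (by positivity) (by positivity)]
    exact (eLpNorm_sub_le a1 a2 (by norm_num)).trans (add_le_add e1 e2)
  rw [← Lp.norm_toLp _ m1, ← Lp.norm_toLp _ m2]
  refine (abs_norm_sub_norm_le _ _).trans_lt ?_
  rw [← MemLp.toLp_sub, Lp.norm_toLp]
  refine (ENNReal.toReal_le_of_le_ofReal (by positivity) e3).trans_lt ?_
  linarith

end Distortion

end GeneralizedNetworks

namespace GeneralizedNetworks

namespace PartitionedMeasureNetwork

/-! ## The distance of partitioned networks -/

variable {k : ℕ}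

/-- The distortion of a tuple of couplings. -/
noncomputable def cost (P P' : PartitionedMeasureNetwork.{u} k)
    (π : ∀ i, Measure (P.X i × P'.X i)) : ℝ≥0∞ :=
  2⁻¹ * (∑ i, ∑ j, eLpNorm (kernelDiff (P.ω i j) (P'.ω i j)) 2 ((π i).prod (π j)) ^ 2) ^
    (1 / 2 : ℝ)

/-- The partitioned network `2`-distance. -/
noncomputable def d (P P' : PartitionedMeasureNetwork.{u} k) : ℝ≥0∞ :=
  ⨅ (π : ∀ i, Measure (P.X i × P'.X i)) (_ : ∀ i, π i ∈ couplings (P.μ i) (P'.μ i)), cost P P' π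

/-- A continuous function on the compact product of the sets of couplings attains its minimum.
Compactness is applied to the finite real sum of squares `F`, of which the cost is a monotone
function. -/
theorem exists_cost_eq_d (P P' : PartitionedMeasureNetwork.{u} k) :
    ∃ π : ∀ i, Measure (P.X i × P'.X i), (∀ i, π i ∈ couplings (P.μ i) (P'.μ i)) ∧
      cost P P' π = P.d P' := by
  let K : Set (∀ i, ProbabilityMeasure (P.X i × P'.X i)) :=
    Set.univ.pi fun i => {π | (π : Measure (P.X i × P'.X i)) ∈ couplings (P.μ i) (P'.μ i)}
  have hK : IsCompact K := isCompact_univ_pi fun i => isCompact_couplings _ _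
  have hne : K.Nonempty := ⟨fun i => ⟨(P.μ i).prod (P'.μ i), inferInstance⟩,
    fun i _ => prod_mem_couplings _ _⟩
  let F : (∀ i, ProbabilityMeasure (P.X i × P'.X i)) → ℝ := fun π =>
    ∑ i, ∑ j, (eLpNorm (kernelDiff (P.ω i j) (P'.ω i j)) 2
      ((π i : Measure _).prod (π j : Measure _))).toReal ^ 2
  have hF : ContinuousOn F K := by
    refine continuousOn_finsetSum _ fun i _ => continuousOn_finsetSum _ fun j _ => ?_
    refine ContinuousOn.pow ?_ 2
    exact (continuousOn_eLpNorm_kernelDiff (P.ω_memLp i j) (P'.ω_memLp i j)).comp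
      (f := fun π : ∀ i, ProbabilityMeasure (P.X i × P'.X i) => (π i, π j))
      (by fun_prop) fun π hπ => ⟨hπ i trivial, hπ j trivial⟩
  have hcost : ∀ π ∈ K, cost P P' (fun i => (π i : Measure (P.X i × P'.X i))) =
      2⁻¹ * ENNReal.ofReal (F π) ^ (1 / 2 : ℝ) := by
    intro π hπ
    rw [cost, ENNReal.ofReal_sum_of_nonneg fun i _ => by positivity]
    congr 2
    refine Finset.sum_congr rfl fun i _ => ?_
    rw [ENNReal.ofReal_sum_of_nonneg fun i _ => by positivity]
    refine Finset.sum_congr rfl fun j _ => ?_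
    rw [ENNReal.ofReal_pow ENNReal.toReal_nonneg, ENNReal.ofReal_toReal]
    exact (memLp_kernelDiff (P.ω_memLp i j) (P'.ω_memLp i j) (hπ i trivial) (hπ j trivial)).2.ne
  obtain ⟨π, hπ, hmin⟩ := hK.exists_isMinOn hne hF
  refine ⟨fun i => (π i : Measure (P.X i × P'.X i)), fun i => hπ i trivial, le_antisymm ?_ ?_⟩
  · refine le_iInf₂ fun ξ hξ => ?_
    have hξK : (fun i => ⟨ξ i, isProbabilityMeasure_of_mem_couplings (hξ i)⟩ :
        ∀ i, ProbabilityMeasure (P.X i × P'.X i)) ∈ K := fun i _ => hξ i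
    refine le_of_eq_of_le (hcost π hπ) (le_of_le_of_eq ?_ (hcost _ hξK).symm)
    gcongr
    exact hmin hξK
  · exact iInf₂_le _ fun i => hπ i trivial

/-! ## Kernels on a common family of probability spaces -/

section Lift

variable {Ω : Fin k → Type*} [∀ i, MeasurableSpace (Ω i)]

/-- The Hilbert space of matrices of square-integrable kernels. -/
abbrev KernelSpace (ℙ : ∀ i, Measure (Ω i)) : Type _ :=
  PiLp 2 fun ij : Fin k × Fin k => Lp ℝ 2 ((ℙ ij.1).prod (ℙ ij.2))

variable {ℙ : ∀ i, Measure (Ω i)} [∀ i, IsProbabilityMeasure (ℙ i)]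
  (P P' : PartitionedMeasureNetwork.{u} k)

theorem memLp_pullback {P : PartitionedMeasureNetwork.{u} k} {φ : ∀ i, Ω i → P.X i}
    (hφ : ∀ i, MeasurePreserving (φ i) (ℙ i) (P.μ i)) (i j : Fin k) :
    MemLp (fun z => P.ω i j (φ i z.1, φ j z.2)) 2 ((ℙ i).prod (ℙ j)) :=
  (P.ω_memLp i j).comp_measurePreserving ((hφ i).prod (hφ j))

/-- The kernel of a partitioned network, pulled back by measure preserving maps. -/
noncomputable def lift (φ : ∀ i, Ω i → P.X i)
    (hφ : ∀ i, MeasurePreserving (φ i) (ℙ i) (P.μ i)) : KernelSpace ℙ :=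
  WithLp.toLp 2 fun ij => (memLp_pullback hφ ij.1 ij.2).toLp

variable {P P'} {φ : ∀ i, Ω i → P.X i} (hφ : ∀ i, MeasurePreserving (φ i) (ℙ i) (P.μ i))
  {φ' : ∀ i, Ω i → P'.X i} (hφ' : ∀ i, MeasurePreserving (φ' i) (ℙ i) (P'.μ i))

theorem lift_nonneg (ij : Fin k × Fin k) : 0 ≤ P.lift φ hφ ij := by
  rw [← Lp.coeFn_nonneg]
  filter_upwards [(memLp_pullback hφ ij.1 ij.2).coeFn_toLp] with z hz
  refine le_of_le_of_eq ?_ hz.symm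
  exact P.ω_nonneg _ _ _

theorem lift_eq_zero {ij : Fin k × Fin k}
    (h : ∀ᵐ z ∂((P.μ ij.1).prod (P.μ ij.2)), P.ω ij.1 ij.2 z = 0) :
    P.lift φ hφ ij = 0 := by
  refine Eq.trans ?_ (MemLp.toLp_zero MemLp.zero')
  exact MemLp.toLp_congr (memLp_pullback hφ ij.1 ij.2) MemLp.zero'
    (((hφ ij.1).prod (hφ ij.2)).quasiMeasurePreserving.ae h)

/-- Change of variables: the kernel difference, pulled back along the joint map, is the difference
of the two lifts. -/
theorem cost_map_eq_edist_lift :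
    P.cost P' (fun i => (ℙ i).map fun w => (φ i w, φ' i w)) =
      2⁻¹ * edist (P.lift φ hφ) (P'.lift φ' hφ') := by
  rw [cost, PiLp.edist_eq_sum (by norm_num), Fintype.sum_prod_type]
  congr 2
  · refine Finset.sum_congr rfl fun i _ => Finset.sum_congr rfl fun j _ => ?_
    have hm : ∀ i, MeasurePreserving (fun w => (φ i w, φ' i w)) (ℙ i)
        ((ℙ i).map fun w => (φ i w, φ' i w)) := fun i =>
      ⟨(hφ i).measurable.prodMk (hφ' i).measurable, rfl⟩
    have hc : ∀ i, (ℙ i).map (fun w => (φ i w, φ' i w)) ∈ couplings (P.μ i) (P'.μ i) :=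
      fun i => map_prodMk_mem_couplings (hφ i) (hφ' i)
    have := fun i => isProbabilityMeasure_of_mem_couplings (hc i)
    rw [← eLpNorm_comp_measurePreserving
      (memLp_kernelDiff (P.ω_memLp i j) (P'.ω_memLp i j) (hc i) (hc j)).1 ((hm i).prod (hm j))]
    simp only [ENNReal.toReal_ofNat, ENNReal.rpow_ofNat]
    refine congrArg (· ^ 2) ?_
    exact (Lp.edist_toLp_toLp _ _ (memLp_pullback hφ i j) (memLp_pullback hφ' i j)).symm

theorem d_le_edist_lift : P.d P' ≤ 2⁻¹ * edist (P.lift φ hφ) (P'.lift φ' hφ') := by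
  rw [← cost_map_eq_edist_lift]
  exact iInf₂_le _ fun i => map_prodMk_mem_couplings (hφ i) (hφ' i)

/-- The real-valued version of the distance. -/
noncomputable def realDist (P P' : PartitionedMeasureNetwork.{u} k) : ℝ := (P.d P').toReal

theorem two_mul_realDist_le : 2 * P.realDist P' ≤ dist (P.lift φ hφ) (P'.lift φ' hφ') := by
  have h := ENNReal.toReal_mono (by finiteness [edist_ne_top (P.lift φ hφ) (P'.lift φ' hφ')])
    (d_le_edist_lift hφ hφ')
  rw [ENNReal.toReal_mul, edist_dist, ENNReal.toReal_ofReal dist_nonneg] at h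
  simp only [ENNReal.toReal_inv, ENNReal.toReal_ofNat] at h
  rw [realDist]
  linarith

theorem d_eq_zero_of_lift_eq (h : P.lift φ hφ = P'.lift φ' hφ') : P.d P' = 0 := by
  have := d_le_edist_lift hφ hφ'
  simpa [h] using this

end Lift

/-! ## Simultaneous optimal realizations -/

/-- When the joint law of the two maps is an optimal coupling, the general bound
`two_mul_realDist_le` is an equality. The factor 2 cancels the `1/2` in the distance. -/
theorem dist_lift_of_optimal {Ω : Fin k → Type*} [∀ i, MeasurableSpace (Ω i)]
    {ℙ : ∀ i, Measure (Ω i)} [∀ i, IsProbabilityMeasure (ℙ i)]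
    {P P' : PartitionedMeasureNetwork.{u} k}
    {φ : ∀ i, Ω i → P.X i} (hφ : ∀ i, MeasurePreserving (φ i) (ℙ i) (P.μ i))
    {φ' : ∀ i, Ω i → P'.X i} (hφ' : ∀ i, MeasurePreserving (φ' i) (ℙ i) (P'.μ i))
    {π : ∀ i, Measure (P.X i × P'.X i)} (hπ : cost P P' π = P.d P')
    (h : ∀ i, (ℙ i).map (fun w => (φ i w, φ' i w)) = π i) :
    dist (P.lift φ hφ) (P'.lift φ' hφ') = 2 * P.realDist P' := by
  have h1 : P.d P' = 2⁻¹ * edist (P.lift φ hφ) (P'.lift φ' hφ') := by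
    rw [← cost_map_eq_edist_lift, ← hπ, funext h]
  rw [realDist, h1, ENNReal.toReal_mul, edist_dist, ENNReal.toReal_ofReal dist_nonneg]
  simp

variable (k) in
/-- The family of constant sample spaces. -/
noncomputable abbrev noises : Fin k → Measure Noise.{u} := fun _ => noise.{u}

theorem exists_star_lift (P : PartitionedMeasureNetwork.{u} k)
    (Q : ℕ → PartitionedMeasureNetwork.{u} k) :
    ∃ (φ : ∀ i, Noise.{u} → P.X i) (hφ : ∀ i, MeasurePreserving (φ i) noise (P.μ i))
      (ψ : ∀ n i, Noise.{u} → (Q n).X i)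
      (hψ : ∀ n i, MeasurePreserving (ψ n i) noise ((Q n).μ i)),
      ∀ n, dist (P.lift (ℙ := noises k) φ hφ) ((Q n).lift (ℙ := noises k) (ψ n) (hψ n)) =
        2 * P.realDist (Q n) := by
  choose π hπ hπd using fun n => exists_cost_eq_d P (Q n)
  have : ∀ n i, Nonempty ((Q n).X i) := fun n i => ((Q n).μ i).nonempty_of_neZero
  choose φ ψ hφ hψ hφμ hψπ using fun i =>
    exists_star_realization.{u} (P.μ i) (fun n => π n i) (fun n => (hπ n i).1)
  refine ⟨φ, fun i => ⟨hφ i, hφμ i⟩, fun n i => ψ i n, fun n i => ⟨hψ i n, ?_⟩, fun n => ?_⟩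
  · rw [← (hπ n i).2, ← hψπ i n, Measure.map_map measurable_snd ((hφ i).prodMk (hψ i n))]
    rfl
  · exact dist_lift_of_optimal _ _ (hπd n) fun i => hψπ i n

/-- This keeps only the metric content of the star: exact distances from the centre, lower bounds
between the other points. -/
theorem exists_star_points (P : PartitionedMeasureNetwork.{u} k)
    (Q : ℕ → PartitionedMeasureNetwork.{u} k) :
    ∃ (f : KernelSpace (noises.{u} k)) (g : ℕ → KernelSpace (noises.{u} k)),
      (∀ n, dist f (g n) = 2 * P.realDist (Q n)) ∧
        ∀ n m, 2 * (Q n).realDist (Q m) ≤ dist (g n) (g m) := by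
  obtain ⟨φ, hφ, ψ, hψ, h⟩ := exists_star_lift P Q
  exact ⟨_, fun n => (Q n).lift (ψ n) (hψ n), h, fun n m => two_mul_realDist_le (hψ n) (hψ m)⟩

theorem exists_chain_lift (Q : ℕ → PartitionedMeasureNetwork.{u} k) :
    ∃ (φ : ∀ n i, Noise.{u} → (Q n).X i)
      (hφ : ∀ n i, MeasurePreserving (φ n i) noise ((Q n).μ i)),
      ∀ n, dist ((Q n).lift (ℙ := noises k) (φ n) (hφ n))
        ((Q (n + 1)).lift (ℙ := noises k) (φ (n + 1)) (hφ (n + 1))) =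
        2 * (Q n).realDist (Q (n + 1)) := by
  choose π hπ hπd using fun n => exists_cost_eq_d (Q n) (Q (n + 1))
  choose φ hφ hφμ hφπ using fun i =>
    exists_chain_realization.{u} (fun n => (Q n).μ i) (fun n => π n i) (fun n => (hπ n i).1)
      (fun n => (hπ n i).2)
  exact ⟨fun n i => φ i n, fun n i => ⟨hφ i n, hφμ i n⟩, fun n =>
    dist_lift_of_optimal _ _ (hπd n) fun i => hφπ i n⟩

/-! ## The distance is a pseudometric vanishing exactly on weakly isomorphic networks -/

theorem d_ne_top (P P' : PartitionedMeasureNetwork.{u} k) : P.d P' ≠ ∞ := by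
  have h := d_le_edist_lift (P := P) (P' := P') (ℙ := fun i => (P.μ i).prod (P'.μ i))
    (fun _ => measurePreserving_fst) (fun _ => measurePreserving_snd)
  refine ne_top_of_le_ne_top ?_ h
  finiteness [edist_ne_top (P.lift (ℙ := fun i => (P.μ i).prod (P'.μ i)) (fun _ => Prod.fst)
    fun _ => measurePreserving_fst) (P'.lift (fun _ => Prod.snd) fun _ => measurePreserving_snd)]

theorem realDist_nonneg (P P' : PartitionedMeasureNetwork.{u} k) : 0 ≤ P.realDist P' :=
  ENNReal.toReal_nonneg

theorem ofReal_realDist (P P' : PartitionedMeasureNetwork.{u} k) :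
    ENNReal.ofReal (P.realDist P') = P.d P' :=
  ENNReal.ofReal_toReal (d_ne_top P P')

theorem realDist_eq_zero_iff_d {P P' : PartitionedMeasureNetwork.{u} k} :
    P.realDist P' = 0 ↔ P.d P' = 0 := by
  simp [realDist, ENNReal.toReal_eq_zero_iff, d_ne_top]

theorem realDist_self (P : PartitionedMeasureNetwork.{u} k) : P.realDist P = 0 :=
  realDist_eq_zero_iff_d.2 <| d_eq_zero_of_lift_eq (ℙ := P.μ) (φ := fun _ => id)
    (fun _ => .id _) (fun _ => .id _) rfl

/-- Gluing at the middle network: in a star centred at `P₂` the Hilbert triangle inequality applies.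
With the sum written from the centre, symmetry is not needed here and follows from this form. -/
theorem realDist_triangle (P₁ P₂ P₃ : PartitionedMeasureNetwork.{u} k) :
    P₁.realDist P₃ ≤ P₂.realDist P₁ + P₂.realDist P₃ := by
  obtain ⟨f, g, h, h'⟩ := exists_star_points P₂ fun n => if n = 0 then P₁ else P₃
  have h0 := h 0
  have h1 := h 1
  have h2 := h' 0 1
  have h3 := dist_triangle_left (g 0) (g 1) f
  simp only [if_true, one_ne_zero, if_false] at h0 h1 h2
  linarith

theorem realDist_comm (P P' : PartitionedMeasureNetwork.{u} k) :
    P.realDist P' = P'.realDist P := by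
  have h1 := realDist_triangle P P' P'
  have h2 := realDist_triangle P' P P
  rw [realDist_self] at h1 h2
  linarith

theorem realDist_eq_zero_iff {P P' : PartitionedMeasureNetwork.{u} k} :
    P.realDist P' = 0 ↔ P.WeaklyIsomorphic P' := by
  rw [realDist_eq_zero_iff_d]
  constructor
  · intro h
    obtain ⟨π, hπ, hcost⟩ := exists_cost_eq_d P P'
    have := fun i => isProbabilityMeasure_of_mem_couplings (hπ i)
    have hφ := fun i => measurePreserving_fst_of_mem_couplings (hπ i)
    have hφ' := fun i => measurePreserving_snd_of_mem_couplings (hπ i)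
    rw [h, cost, mul_eq_zero, ENNReal.rpow_eq_zero_iff] at hcost
    simp only [ENNReal.inv_eq_zero, ENNReal.ofNat_ne_top, one_div, inv_pos, Nat.ofNat_pos,
      and_true, not_lt_of_gt, and_false, or_false, false_or,
      Finset.sum_eq_zero_iff, Finset.mem_univ, true_implies] at hcost
    have hz : ∀ i j, ∀ᵐ z ∂((π i).prod (π j)), P.ω i j (z.1.1, z.2.1) =
        P'.ω i j (z.1.2, z.2.2) := by
      intro i j
      have h0 := pow_eq_zero_iff (two_ne_zero) |>.1 (hcost i j)
      rw [eLpNorm_eq_zero_iff (memLp_kernelDiff (P.ω_memLp i j) (P'.ω_memLp i j)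
        (hπ i) (hπ j)).1 (by norm_num)] at h0
      filter_upwards [h0] with z hz
      exact sub_eq_zero.1 hz
    -- The common network is the support of an optimal coupling: the product spaces carry `π` and
    -- the kernel of `P`, which agrees almost everywhere with that of `P'` because the cost is zero.
    let Q : PartitionedMeasureNetwork.{u} k :=
      { X := fun i => P.X i × P'.X i
        μ := π
        ω := fun i j z => P.ω i j (z.1.1, z.2.1)
        ω_nonneg := fun i j z => P.ω_nonneg i j _
        ω_memLp := fun i j =>
          (P.ω_memLp i j).comp_measurePreserving ((hφ i).prod (hφ j)) }
    exact ⟨Q, fun i => Prod.fst, fun i => Prod.snd,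
      ⟨hφ, fun i j => .of_forall fun z => rfl⟩, ⟨hφ', hz⟩⟩
  · rintro ⟨Q, φ, φ', h, h'⟩
    refine d_eq_zero_of_lift_eq (ℙ := Q.μ) h.measurePreserving h'.measurePreserving ?_
    refine congrArg (WithLp.toLp 2) (funext fun ij => ?_)
    refine MemLp.toLp_congr _ _ ?_
    filter_upwards [h.kernel_eq ij.1 ij.2, h'.kernel_eq ij.1 ij.2] with z h1 h2
    rw [← h1, ← h2]

end PartitionedMeasureNetwork

end GeneralizedNetworks

namespace GeneralizedNetworks

open Filter Topology

/-! ## Two facts about points of a Hilbert space -/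

section Hilbert

variable {H : Type*} [NormedAddCommGroup H] [InnerProductSpace ℝ H]

theorem norm_convexCombination_sub_sq (a b x : H) (t : ℝ) :
    ‖(1 - t) • a + t • b - x‖ ^ 2 =
      (1 - t) * ‖a - x‖ ^ 2 + t * ‖b - x‖ ^ 2 - t * (1 - t) * ‖a - b‖ ^ 2 := by
  have h1 : (1 - t) • a + t • b - x = (1 - t) • (a - x) + t • (b - x) := by module
  have h2 : a - b = (a - x) - (b - x) := by abel
  rw [h1, h2, norm_add_sq_real, norm_sub_sq_real (a - x), norm_smul, norm_smul, inner_smul_left,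
    inner_smul_right, mul_pow, mul_pow, Real.norm_eq_abs, Real.norm_eq_abs, sq_abs, sq_abs]
  simp only [conj_trivial]
  ring

/-- The comparison inequality for a point dividing a segment in the ratio `t : 1 - t`. -/
theorem le_dist_sq_of_dist_eq {a b c x : H} {t D : ℝ} (hab : D ≤ dist a b)
    (hac : dist c a = t * D) (hcb : dist c b = (1 - t) * D) :
    (1 - t) * dist a x ^ 2 + t * dist b x ^ 2 - t * (1 - t) * D ^ 2 ≤ dist c x ^ 2 := by
  have hle : dist a b ≤ D := by
    have := dist_triangle_left a b c
    rw [hac, hcb] at this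
    linarith
  obtain rfl : D = dist a b := le_antisymm hab hle
  -- Equality in the triangle inequality forces `c` onto the segment: the identity with `x = c`
  -- evaluates to zero.
  have hc : (1 - t) • a + t • b = c := by
    have h := norm_convexCombination_sub_sq a b c t
    rw [← dist_eq_norm a c, ← dist_eq_norm b c, ← dist_eq_norm a b, dist_comm a c,
      dist_comm b c, hac, hcb] at h
    have h0 : ‖(1 - t) • a + t • b - c‖ ^ 2 = 0 := by rw [h]; ring
    exact sub_eq_zero.1 (norm_eq_zero.1 (pow_eq_zero_iff two_ne_zero |>.1 h0))
  have h := norm_convexCombination_sub_sq a b x t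
  rw [hc] at h
  simp only [dist_eq_norm]
  exact h.ge

end Hilbert

theorem Lp_smul_nonneg {Z : Type*} [MeasurableSpace Z] {μ : Measure Z} {r : ℝ} (hr : 0 ≤ r)
    {f : Lp ℝ 2 μ} (hf : 0 ≤ f) : 0 ≤ r • f := by
  rw [← Lp.coeFn_nonneg] at hf ⊢
  filter_upwards [hf, Lp.coeFn_smul r f] with z h1 h2
  rw [h2]
  exact mul_nonneg hr h1

namespace PartitionedMeasureNetwork

variable {k : ℕ}

/-- The kernel vanishes outside of the blocks in `S`. -/
def IsSupportedOn (S : Set (Fin k × Fin k)) (P : PartitionedMeasureNetwork.{u} k) : Prop :=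
  ∀ ij, ij ∉ S → ∀ᵐ z ∂((P.μ ij.1).prod (P.μ ij.2)), P.ω ij.1 ij.2 z = 0

/-! ## Networks on the common sample space -/

/-- The partitioned network given by (the positive part of) a matrix of kernels on the common
sample space. -/
noncomputable def ofKernel (F : KernelSpace (noises.{u} k)) : PartitionedMeasureNetwork.{u} k where
  X _ := Noise.{u}
  μ _ := noise.{u}
  ω i j z := max (F (i, j) z) 0
  ω_nonneg _ _ _ := le_max_right _ _
  ω_memLp i j := (Lp.memLp (F (i, j))).sup MemLp.zero'

/-- On nonnegative matrices the positive part changes nothing almost everywhere, so `ofKernel`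
followed by the identity lift returns `F`. -/
theorem lift_ofKernel {F : KernelSpace (noises.{u} k)} (hF : ∀ ij, 0 ≤ F ij) :
    (ofKernel F).lift (ℙ := noises k) (fun _ => id) (fun _ => .id _) = F := by
  refine PiLp.ext fun ij => Lp.ext ?_
  have h := (memLp_pullback (P := ofKernel F) (ℙ := noises k) (φ := fun _ => id)
    (fun _ => .id _) ij.1 ij.2).coeFn_toLp
  filter_upwards [h, (Lp.coeFn_nonneg _).2 (hF ij)] with z h1 h2
  exact h1.trans (max_eq_left h2)

theorem isSupportedOn_ofKernel {S : Set (Fin k × Fin k)} {F : KernelSpace (noises.{u} k)}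
    (hF : ∀ ij, ij ∉ S → F ij = 0) : (ofKernel F).IsSupportedOn S := by
  intro ij hij
  have h := Lp.coeFn_zero ℝ 2 ((noises.{u} k ij.1).prod (noises.{u} k ij.2))
  rw [← hF ij hij] at h
  filter_upwards [h] with z hz
  exact (congrArg (max · 0) hz).trans (max_self 0)

theorem two_mul_realDist_ofKernel_le (P : PartitionedMeasureNetwork.{u} k)
    {φ : ∀ i, Noise.{u} → P.X i} (hφ : ∀ i, MeasurePreserving (φ i) noise (P.μ i))
    {F : KernelSpace (noises.{u} k)} (hF : ∀ ij, 0 ≤ F ij) :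
    2 * P.realDist (ofKernel F) ≤ dist (P.lift (ℙ := noises k) φ hφ) F := by
  have h := two_mul_realDist_le (ℙ := noises k) (P := P) (P' := ofKernel F) hφ
    (φ' := fun _ => id) (fun _ => .id _)
  rwa [lift_ofKernel hF] at h

/-! ## Completeness, geodesics and curvature -/

theorem exists_tendsto_realDist {S : Set (Fin k × Fin k)}
    {Q : ℕ → PartitionedMeasureNetwork.{u} k} (hQ : ∀ n, (Q n).IsSupportedOn S)
    (h : ∀ n, (Q n).realDist (Q (n + 1)) ≤ (1 / 2) ^ n) :
    ∃ P : PartitionedMeasureNetwork.{u} k, P.IsSupportedOn S ∧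
      Tendsto (fun n => (Q n).realDist P) atTop (𝓝 0) := by
  obtain ⟨φ, hφ, hd⟩ := exists_chain_lift Q
  let f : ℕ → KernelSpace (noises.{u} k) := fun n => (Q n).lift (ℙ := noises k) (φ n) (hφ n)
  -- Consecutive points of the chain are optimally coupled, so the summable bound on network
  -- distances passes to the Hilbert space with constant 2.
  have hf : CauchySeq f := cauchySeq_of_le_geometric (1 / 2) 2 (by norm_num) fun n => by
    change dist ((Q n).lift (ℙ := noises k) (φ n) (hφ n)) _ ≤ _
    rw [hd n]
    exact mul_le_mul_of_nonneg_left (h n) (by norm_num)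
  obtain ⟨F, hF⟩ := cauchySeq_tendsto_of_complete hf
  have hFij : ∀ ij, Tendsto (fun n => f n ij) atTop (𝓝 (F ij)) := fun ij =>
    ((PiLp.continuous_apply 2 _ ij).tendsto F).comp hF
  have hF0 : ∀ ij, 0 ≤ F ij := fun ij =>
    ge_of_tendsto' (hFij ij) fun n => lift_nonneg (ℙ := noises k) (hφ n) ij
  refine ⟨ofKernel F, isSupportedOn_ofKernel fun ij hij => ?_, ?_⟩
  · refine tendsto_nhds_unique (hFij ij) ?_
    have : ∀ n, f n ij = 0 := fun n => lift_eq_zero (ℙ := noises k) (hφ n) (hQ n ij hij)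
    simp [this]
  · refine squeeze_zero (fun n => realDist_nonneg _ _) (fun n => ?_)
      (tendsto_iff_dist_tendsto_zero.1 hF)
    have h1 := two_mul_realDist_ofKernel_le (Q n) (hφ n) hF0
    have h2 := realDist_nonneg (Q n) (ofKernel F)
    change _ ≤ dist ((Q n).lift (ℙ := noises k) (φ n) (hφ n)) F
    linarith

/-- The path is the segment between optimally coupled lifts. Only upper bounds are recorded, since
equality then follows from the triangle inequality. -/
theorem exists_geodesic {S : Set (Fin k × Fin k)} {P P' : PartitionedMeasureNetwork.{u} k}
    (hP : P.IsSupportedOn S) (hP' : P'.IsSupportedOn S) :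
    ∃ γ : unitInterval → PartitionedMeasureNetwork.{u} k, (∀ t, (γ t).IsSupportedOn S) ∧
      P.realDist (γ 0) = 0 ∧ P'.realDist (γ 1) = 0 ∧
      ∀ s t, s ≤ t → (γ s).realDist (γ t) ≤ ((t : ℝ) - s) * P.realDist P' := by
  obtain ⟨φ, hφ, ψ, hψ, h⟩ := exists_star_lift P fun _ => P'
  set a := P.lift (ℙ := noises k) φ hφ
  set b := P'.lift (ℙ := noises k) (ψ 0) (hψ 0)
  have hab : dist a b = 2 * P.realDist P' := h 0
  let c : unitInterval → KernelSpace (noises.{u} k) := fun t => (1 - (t : ℝ)) • a + (t : ℝ) • b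
  have hc : ∀ t ij, 0 ≤ c t ij := fun t ij =>
    add_nonneg (Lp_smul_nonneg (sub_nonneg.2 t.2.2) (lift_nonneg (ℙ := noises k) hφ ij))
      (Lp_smul_nonneg t.2.1 (lift_nonneg (ℙ := noises k) (hψ 0) ij))
  refine ⟨fun t => ofKernel (c t), fun t => isSupportedOn_ofKernel fun ij hij => ?_, ?_, ?_, ?_⟩
  · change (1 - (t : ℝ)) • a ij + (t : ℝ) • b ij = 0
    rw [lift_eq_zero (ℙ := noises k) hφ (hP ij hij),
      lift_eq_zero (ℙ := noises k) (hψ 0) (hP' ij hij)]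
    simp
  · have h1 := two_mul_realDist_ofKernel_le P hφ (hc 0)
    have h2 : c 0 = a := by simp [c]
    rw [h2, dist_self] at h1
    beta_reduce
    rw [h2]
    exact le_antisymm (by linarith) (realDist_nonneg _ _)
  · have h1 := two_mul_realDist_ofKernel_le P' (hψ 0) (hc 1)
    have h2 : c 1 = b := by simp [c]
    rw [h2, dist_self] at h1
    beta_reduce
    rw [h2]
    exact le_antisymm (by linarith) (realDist_nonneg _ _)
  · intro s t hst
    have h1 := two_mul_realDist_ofKernel_le (ofKernel (c s)) (φ := fun _ => id)
      (fun _ => .id _) (hc t)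
    rw [lift_ofKernel (hc s)] at h1
    have h2 : dist (c s) (c t) = ((t : ℝ) - s) * dist a b := by
      have : c s - c t = ((t : ℝ) - s) • (a - b) := by
        simp only [c]
        module
      rw [dist_eq_norm, this, norm_smul, ← dist_eq_norm a b, Real.norm_of_nonneg (sub_nonneg.2 hst)]
    rw [h2, hab] at h1
    linarith

theorem realDist_comparison {P₀ P₁ P Q : PartitionedMeasureNetwork.{u} k} {t : ℝ} (ht : 0 ≤ t)
    (ht' : t ≤ 1) (h₀ : P.realDist P₀ = t * P₀.realDist P₁)
    (h₁ : P.realDist P₁ = (1 - t) * P₀.realDist P₁) :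
    (1 - t) * P₀.realDist Q ^ 2 + t * P₁.realDist Q ^ 2
      - t * (1 - t) * P₀.realDist P₁ ^ 2 ≤ P.realDist Q ^ 2 := by
  -- The star is centred at the intermediate network `P`, with `P₀`, `P₁` and `Q` as legs 0, 1 and
  -- 2. The Hilbert distances from `P₀` and `P₁` to `Q` enter with nonnegative weights, so replacing
  -- them by the smaller network distances is harmless.
  obtain ⟨f, g, h, h'⟩ := exists_star_points P fun n => Nat.casesOn n P₀ fun n =>
    Nat.casesOn n P₁ fun _ => Q
  have e0 : dist f (g 0) = 2 * P.realDist P₀ := h 0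
  have e1 : dist f (g 1) = 2 * P.realDist P₁ := h 1
  have e2 : dist f (g 2) = 2 * P.realDist Q := h 2
  have l01 : 2 * P₀.realDist P₁ ≤ dist (g 0) (g 1) := h' 0 1
  have l02 : 2 * P₀.realDist Q ≤ dist (g 0) (g 2) := h' 0 2
  have l12 : 2 * P₁.realDist Q ≤ dist (g 1) (g 2) := h' 1 2
  have key := le_dist_sq_of_dist_eq (x := g 2) (t := t) l01 (e0.trans (by rw [h₀]; ring))
    (e1.trans (by rw [h₁]; ring))
  have s02 := mul_le_mul_of_nonneg_left
    (pow_le_pow_left₀ (by have := realDist_nonneg P₀ Q; positivity) l02 2) (sub_nonneg.2 ht')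
  have s12 := mul_le_mul_of_nonneg_left
    (pow_le_pow_left₀ (by have := realDist_nonneg P₁ Q; positivity) l12 2) ht
  rw [e2] at key
  linarith

end PartitionedMeasureNetwork

end GeneralizedNetworks

namespace GeneralizedNetworks

open Filter Topology

namespace PartitionedMeasureNetwork

variable {k : ℕ}

/-! ## Passing to classes -/

theorem realDist_congr {P P' Q Q' : PartitionedMeasureNetwork.{u} k}
    (h : P.WeaklyIsomorphic P') (h' : Q.WeaklyIsomorphic Q') : P.realDist Q = P'.realDist Q' := by
  rw [← realDist_eq_zero_iff] at h h'
  have h1 := realDist_triangle P P' Q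
  have h2 := realDist_triangle P' Q' Q
  have h3 := realDist_triangle P' P Q'
  have h4 := realDist_triangle P Q Q'
  have := realDist_comm P P'
  have := realDist_comm Q Q'
  have := realDist_comm Q P
  have := realDist_comm Q' P'
  linarith

theorem weaklyIsomorphic_equivalence :
    Equivalence (WeaklyIsomorphic : PartitionedMeasureNetwork.{u} k → _ → Prop) where
  refl P := realDist_eq_zero_iff.1 (realDist_self P)
  symm {P Q} h := by
    rw [← realDist_eq_zero_iff] at h ⊢
    rwa [realDist_comm]
  trans {P Q R} h h' := by
    rw [← realDist_eq_zero_iff] at h h' ⊢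
    have := realDist_triangle P Q R
    rw [realDist_comm Q P, h, h', add_zero] at this
    exact le_antisymm this (realDist_nonneg _ _)

/-- A class of networks which embeds as the class of `k`-partitioned networks supported on a
set `S` of blocks is an Alexandrov space of non-negative curvature. -/
theorem isAlexandrovNonnegModulo_of_embedding {α : Type*} {r : α → α → Prop}
    {d : α → α → ℝ≥0∞} (ι : α → PartitionedMeasureNetwork.{u} k) (S : Set (Fin k × Fin k))
    (hr : ∀ x y, r x y ↔ (ι x).WeaklyIsomorphic (ι y)) (hd : ∀ x y, d x y = (ι x).d (ι y))
    (hS : ∀ x, (ι x).IsSupportedOn S)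
    (hι : ∀ P : PartitionedMeasureNetwork.{u} k, P.IsSupportedOn S →
      ∃ x, (ι x).WeaklyIsomorphic P) :
    IsAlexandrovNonnegModulo r d := by
  have hequiv := weaklyIsomorphic_equivalence (k := k)
  have hre : Equivalence r :=
    ⟨fun x => (hr _ _).2 (hequiv.refl _), fun h => (hr _ _).2 (hequiv.symm ((hr _ _).1 h)),
      fun h h' => (hr _ _).2 (hequiv.trans ((hr _ _).1 h) ((hr _ _).1 h'))⟩
  let m : MetricSpace (Quot r) :=
    { dist := Quot.lift₂ (fun x y => (ι x).realDist (ι y))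
        (fun x y z h => realDist_congr (hequiv.refl _) ((hr _ _).1 h))
        (fun x y z h => realDist_congr ((hr _ _).1 h) (hequiv.refl _))
      dist_self := by
        rintro ⟨x⟩
        exact realDist_self _
      dist_comm := by
        rintro ⟨x⟩ ⟨y⟩
        exact realDist_comm _ _
      dist_triangle := by
        rintro ⟨x⟩ ⟨y⟩ ⟨z⟩
        exact (realDist_triangle _ (ι y) _).trans_eq (by rw [realDist_comm (ι y) (ι x)]; rfl)
      eq_of_dist_eq_zero := by
        rintro ⟨x⟩ ⟨y⟩ h
        exact Quot.sound ((hr _ _).2 (realDist_eq_zero_iff.1 h)) }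
  have hdist : ∀ x y, dist (Quot.mk r x) (Quot.mk r y) = (ι x).realDist (ι y) := fun x y => rfl
  refine ⟨hre, m, fun x y => ?_, ?_, ?_, ?_⟩
  · rw [edist_dist, hdist, ofReal_realDist, hd]
  · refine Metric.complete_of_convergent_controlled_sequences (fun n => (1 / 2) ^ n)
      (fun n => by positivity) fun u hu => ?_
    choose x hx using fun n => Quot.exists_rep (u n)
    obtain ⟨P, hP, hlim⟩ := exists_tendsto_realDist (Q := fun n => ι (x n)) (fun n => hS _)
      (fun n => by
        rw [← hdist, hx, hx]
        exact (hu n n (n + 1) le_rfl n.le_succ).le)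
    obtain ⟨y, hy⟩ := hι P hP
    refine ⟨Quot.mk r y, tendsto_iff_dist_tendsto_zero.2 (hlim.congr fun n => ?_)⟩
    rw [← hx, hdist]
    exact realDist_congr (hequiv.refl _) (hequiv.symm hy)
  · rintro ⟨x⟩ ⟨y⟩
    obtain ⟨γ, hγS, hγ0, hγ1, hγ⟩ := exists_geodesic (hS x) (hS y)
    choose c hc using fun t => hι (γ t) (hγS t)
    have hle : ∀ s t : unitInterval, s ≤ t →
        (ι (c s)).realDist (ι (c t)) ≤ ((t : ℝ) - s) * (ι x).realDist (ι y) := fun s t hst =>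
      (realDist_congr (hc s) (hc t)).trans_le (hγ s t hst)
    have h0 := hequiv.trans (hc 0) (hequiv.symm (realDist_eq_zero_iff.1 hγ0))
    have h1 := hequiv.trans (hc 1) (hequiv.symm (realDist_eq_zero_iff.1 hγ1))
    refine ⟨fun t => Quot.mk r (c t), Quot.sound ((hr _ _).2 h0), Quot.sound ((hr _ _).2 h1),
      fun s t hst => (hle s t hst).antisymm ?_⟩
    -- If the distance from `s` to `t` were smaller, the bounds on `[0, s]` and `[t, 1]` would make
    -- the path from 0 to 1 shorter than its endpoints allow.
    change _ * (ι x).realDist (ι y) ≤ (ι (c s)).realDist (ι (c t))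
    have e1 := hle 0 s s.2.1
    have e2 := hle t 1 t.2.2
    have e3 := realDist_triangle (ι (c 0)) (ι (c s)) (ι (c 1))
    have e4 := realDist_triangle (ι (c s)) (ι (c t)) (ι (c 1))
    rw [realDist_congr h0 h1, realDist_comm (ι (c s))] at e3
    rw [realDist_comm (ι (c t)) (ι (c s))] at e4
    simp only [Set.Icc.coe_zero, Set.Icc.coe_one] at e1 e2
    linarith
  · intro γ hγ q t
    obtain ⟨x₀, hx₀⟩ := Quot.exists_rep (γ 0)
    obtain ⟨x₁, hx₁⟩ := Quot.exists_rep (γ 1)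
    obtain ⟨x, hx⟩ := Quot.exists_rep (γ t)
    obtain ⟨y, rfl⟩ := Quot.exists_rep q
    have e0 := hγ.dist_eq 0 t t.2.1
    have e1 := hγ.dist_eq t 1 t.2.2
    rw [dist_comm] at e0
    rw [← hx₀, ← hx₁, ← hx] at e0 e1 ⊢
    simp only [hdist, Set.Icc.coe_zero, Set.Icc.coe_one, sub_zero] at e0 e1 ⊢
    exact realDist_comparison t.2.1 t.2.2 e0 e1

end PartitionedMeasureNetwork

/-! ## The three classes of networks -/

open PartitionedMeasureNetwork

theorem eLpNorm_kernelDiff_zero {A A' B B' : Type*} [MeasurableSpace A] [MeasurableSpace A']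
    [MeasurableSpace B] [MeasurableSpace B'] (m : Measure ((A × A') × (B × B'))) :
    eLpNorm (kernelDiff (fun _ : A × B => (0 : ℝ)) (fun _ : A' × B' => 0)) 2 m = 0 := by
  have : kernelDiff (fun _ : A × B => (0 : ℝ)) (fun _ : A' × B' => 0) = 0 := by
    funext z
    simp [kernelDiff]
  rw [this, eLpNorm_zero]

theorem sq_rpow_half (x : ℝ≥0∞) : (x ^ 2) ^ (1 / 2 : ℝ) = x := by
  rw [← ENNReal.rpow_natCast, ← ENNReal.rpow_mul]
  norm_num

theorem MeasureNetwork.d_eq (N N' : MeasureNetwork.{u}) :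
    N.d N' = N.toPartitioned.d N'.toPartitioned := by
  have hcost : ∀ π : ∀ i, Measure (N.toPartitioned.X i × N'.toPartitioned.X i),
      PartitionedMeasureNetwork.cost N.toPartitioned N'.toPartitioned π =
        2⁻¹ * eLpNorm (kernelDiff N.ω N'.ω) 2 ((π 0).prod (π 0)) := by
    intro π
    rw [PartitionedMeasureNetwork.cost, Fin.sum_univ_one, Fin.sum_univ_one, sq_rpow_half]
    rfl
  refine le_antisymm (le_iInf₂ fun π hπ => ?_) (le_iInf₂ fun π hπ => ?_)
  · exact (iInf₂_le (π 0) (hπ 0)).trans_eq (hcost π).symm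
  · exact (iInf₂_le (fun _ => π) (fun _ => hπ)).trans_eq (hcost _)

/-- The pair of measures on the two products of corresponding spaces. -/
def pairCoupling {A B A' B' : Type u} [MeasurableSpace A] [MeasurableSpace B]
    [MeasurableSpace A'] [MeasurableSpace B'] (π : Measure (A × A')) (ξ : Measure (B × B')) :
    ∀ i, Measure (Pair A B i × Pair A' B' i)
  | 0 => π
  | 1 => ξ

theorem MeasureHypernetwork.d_eq (H H' : MeasureHypernetwork.{u}) :
    H.d H' = H.toPartitioned.d H'.toPartitioned := by
  have hcost : ∀ π : ∀ i, Measure (H.toPartitioned.X i × H'.toPartitioned.X i),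
      PartitionedMeasureNetwork.cost H.toPartitioned H'.toPartitioned π =
        2⁻¹ * eLpNorm (kernelDiff H.ω H'.ω) 2 (Measure.prod (π 0) (π 1)) := by
    intro π
    rw [PartitionedMeasureNetwork.cost, Fin.sum_univ_two, Fin.sum_univ_two, Fin.sum_univ_two]
    have h00 : eLpNorm (kernelDiff (H.toPartitioned.ω 0 0) (H'.toPartitioned.ω 0 0)) 2
      (Measure.prod (π 0) (π 0)) = 0 := eLpNorm_kernelDiff_zero _
    have h10 : eLpNorm (kernelDiff (H.toPartitioned.ω 1 0) (H'.toPartitioned.ω 1 0)) 2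
      (Measure.prod (π 1) (π 0)) = 0 := eLpNorm_kernelDiff_zero _
    have h11 : eLpNorm (kernelDiff (H.toPartitioned.ω 1 1) (H'.toPartitioned.ω 1 1)) 2
      (Measure.prod (π 1) (π 1)) = 0 := eLpNorm_kernelDiff_zero _
    rw [h00, h10, h11, zero_pow two_ne_zero, zero_add, add_zero, add_zero, sq_rpow_half]
    rfl
  refine le_antisymm (le_iInf₂ fun π hπ => ?_) (le_iInf₂ fun π hπ => le_iInf₂ fun ξ hξ => ?_)
  · refine (iInf₂_le (π 0) (hπ 0)).trans ?_
    exact (iInf₂_le (π 1) (hπ 1)).trans_eq (hcost π).symm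
  · refine (iInf₂_le (pairCoupling π ξ) fun i => ?_).trans_eq (hcost _)
    match i with
    | 0 => exact hπ
    | 1 => exact hξ

theorem AugmentedMeasureNetwork.d_eq (A A' : AugmentedMeasureNetwork.{u}) :
    A.d A' = A.toPartitioned.d A'.toPartitioned := by
  have hcost : ∀ π : ∀ i, Measure (A.toPartitioned.X i × A'.toPartitioned.X i),
      PartitionedMeasureNetwork.cost A.toPartitioned A'.toPartitioned π =
        2⁻¹ * (eLpNorm (kernelDiff A.ωX A'.ωX) 2 (Measure.prod (π 0) (π 0)) ^ 2 +
          eLpNorm (kernelDiff A.ωXY A'.ωXY) 2 (Measure.prod (π 0) (π 1)) ^ 2) ^ (1 / 2 : ℝ) := by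
    intro π
    rw [PartitionedMeasureNetwork.cost, Fin.sum_univ_two, Fin.sum_univ_two, Fin.sum_univ_two]
    have h10 : eLpNorm (kernelDiff (A.toPartitioned.ω 1 0) (A'.toPartitioned.ω 1 0)) 2
      (Measure.prod (π 1) (π 0)) = 0 := eLpNorm_kernelDiff_zero _
    have h11 : eLpNorm (kernelDiff (A.toPartitioned.ω 1 1) (A'.toPartitioned.ω 1 1)) 2
      (Measure.prod (π 1) (π 1)) = 0 := eLpNorm_kernelDiff_zero _
    rw [h10, h11, zero_pow two_ne_zero, add_zero, add_zero]
    rfl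
  refine le_antisymm (le_iInf₂ fun π hπ => ?_) (le_iInf₂ fun π hπ => le_iInf₂ fun ξ hξ => ?_)
  · refine (iInf₂_le (π 0) (hπ 0)).trans ?_
    exact (iInf₂_le (π 1) (hπ 1)).trans_eq (hcost π).symm
  · refine (iInf₂_le (pairCoupling π ξ) fun i => ?_).trans_eq (hcost _)
    match i with
    | 0 => exact hπ
    | 1 => exact hξ

/-- The identification of the pair `(X 0, X 1)` with a family of two spaces. -/
def fromPair (X : Fin 2 → Type u) : ∀ i, Pair (X 0) (X 1) i → X i
  | 0 => id
  | 1 => id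

theorem isAlexandrovNonnegModulo_measureNetwork :
    IsAlexandrovNonnegModulo MeasureNetwork.WeaklyIsomorphic.{u} MeasureNetwork.d.{u} := by
  refine isAlexandrovNonnegModulo_of_embedding MeasureNetwork.toPartitioned Set.univ
    (fun _ _ => Iff.rfl) MeasureNetwork.d_eq (fun N ij h => (h trivial).elim) fun P hP => ?_
  let N : MeasureNetwork.{u} := ⟨P.X 0, P.μ 0, P.ω 0 0, P.ω_nonneg 0 0, P.ω_memLp 0 0⟩
  refine ⟨N, N.toPartitioned, fun _ => id, Fin.cons id fun i => i.elim0,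
    ⟨fun _ => .id _, fun _ _ => .of_forall fun _ => rfl⟩, fun i => ?_, fun i j => ?_⟩
  · match i with
    | 0 => exact .id _
  · match i, j with
    | 0, 0 => exact .of_forall fun _ => rfl

theorem isAlexandrovNonnegModulo_measureHypernetwork :
    IsAlexandrovNonnegModulo MeasureHypernetwork.WeaklyIsomorphic.{u}
      MeasureHypernetwork.d.{u} := by
  refine isAlexandrovNonnegModulo_of_embedding MeasureHypernetwork.toPartitioned {(0, 1)}
    (fun _ _ => Iff.rfl) MeasureHypernetwork.d_eq (fun H ij h => ?_) fun P hP => ?_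
  · match ij with
    | (0, 0) => exact .of_forall fun _ => rfl
    | (0, 1) => exact (h rfl).elim
    | (1, 0) => exact .of_forall fun _ => rfl
    | (1, 1) => exact .of_forall fun _ => rfl
  -- Discarding the null blocks of `P` and putting exact zeros there changes the kernel only on null
  -- sets, so `H` already serves as the common network.
  · let H : MeasureHypernetwork.{u} :=
      ⟨P.X 0, P.μ 0, P.X 1, P.μ 1, P.ω 0 1, P.ω_nonneg 0 1, P.ω_memLp 0 1⟩
    have h0 : ∀ ij, ij ∉ ({(0, 1)} : Set (Fin 2 × Fin 2)) →
        ∀ᵐ z ∂((P.μ ij.1).prod (P.μ ij.2)), 0 = P.ω ij.1 ij.2 z := fun ij hij =>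
      (hP ij hij).mono fun _ => Eq.symm
    refine ⟨H, H.toPartitioned, fun _ => id, fromPair P.X,
      ⟨fun _ => .id _, fun _ _ => .of_forall fun _ => rfl⟩, fun i => ?_, fun i j => ?_⟩
    · match i with
      | 0 => exact .id _
      | 1 => exact .id _
    · match i, j with
      | 0, 0 => exact h0 (0, 0) (by simp)
      | 0, 1 => exact .of_forall fun _ => rfl
      | 1, 0 => exact h0 (1, 0) (by simp)
      | 1, 1 => exact h0 (1, 1) (by simp)

theorem isAlexandrovNonnegModulo_augmentedMeasureNetwork :
    IsAlexandrovNonnegModulo AugmentedMeasureNetwork.WeaklyIsomorphic.{u}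
      AugmentedMeasureNetwork.d.{u} := by
  refine isAlexandrovNonnegModulo_of_embedding AugmentedMeasureNetwork.toPartitioned
    {(0, 0), (0, 1)} (fun _ _ => Iff.rfl) AugmentedMeasureNetwork.d_eq (fun H ij h => ?_)
    fun P hP => ?_
  · match ij with
    | (0, 0) => exact (h (Or.inl rfl)).elim
    | (0, 1) => exact (h (Or.inr rfl)).elim
    | (1, 0) => exact .of_forall fun _ => rfl
    | (1, 1) => exact .of_forall fun _ => rfl
  · let A : AugmentedMeasureNetwork.{u} :=
      ⟨P.X 0, P.μ 0, P.X 1, P.μ 1, P.ω 0 0, P.ω_nonneg 0 0, P.ω_memLp 0 0,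
        P.ω 0 1, P.ω_nonneg 0 1, P.ω_memLp 0 1⟩
    have h0 : ∀ ij, ij ∉ ({(0, 0), (0, 1)} : Set (Fin 2 × Fin 2)) →
        ∀ᵐ z ∂((P.μ ij.1).prod (P.μ ij.2)), 0 = P.ω ij.1 ij.2 z := fun ij hij =>
      (hP ij hij).mono fun _ => Eq.symm
    refine ⟨A, A.toPartitioned, fun _ => id, fromPair P.X,
      ⟨fun _ => .id _, fun _ _ => .of_forall fun _ => rfl⟩, fun i => ?_, fun i j => ?_⟩
    · match i with
      | 0 => exact .id _
      | 1 => exact .id _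
    · match i, j with
      | 0, 0 => exact .of_forall fun _ => rfl
      | 0, 1 => exact .of_forall fun _ => rfl
      | 1, 0 => exact h0 (1, 0) (by simp)
      | 1, 1 => exact h0 (1, 1) (by simp)

end GeneralizedNetworks

theorem corollary2 :
    GeneralizedNetworks.IsAlexandrovNonnegModulo
      GeneralizedNetworks.MeasureNetwork.WeaklyIsomorphic.{u}
      GeneralizedNetworks.MeasureNetwork.d.{u} ∧
    GeneralizedNetworks.IsAlexandrovNonnegModulo
      GeneralizedNetworks.MeasureHypernetwork.WeaklyIsomorphic.{u}
      GeneralizedNetworks.MeasureHypernetwork.d.{u} ∧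
    GeneralizedNetworks.IsAlexandrovNonnegModulo
      GeneralizedNetworks.AugmentedMeasureNetwork.WeaklyIsomorphic.{u}
      GeneralizedNetworks.AugmentedMeasureNetwork.d.{u} :=
  ⟨GeneralizedNetworks.isAlexandrovNonnegModulo_measureNetwork,
    GeneralizedNetworks.isAlexandrovNonnegModulo_measureHypernetwork,
    GeneralizedNetworks.isAlexandrovNonnegModulo_augmentedMeasureNetwork⟩
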